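/- Let $n\ge 1$ and $m\ge 0$ be integers. For $r\ge 0$ let $S^r$ be the space of symmetric complex tensors $u=(u_{i_1\dots i_r})$, $1\le i_1,\dots,i_r\le n$, of rank $r$ on $\mathbb R^n$ (components in the standard orthonormal basis; repeated indices are summed). For $u\in S^r$ let $i_u:S^k\to S^{k+r}$ be symmetric multiplication by $u$, $i_uv=\sigma(u\otimes v)$, where $\sigma$ is the symmetrization in all indices (the average over all permutations of the indices), and let $j_u:S^{k+r}\to S^k$ be the contraction $$(j_uv)_{i_1\dots i_k}=v_{i_1\dots i_kl_1\dots l_r}\,u^{l_1\dots l_r}=:(v/u)_{i_1\dots i_k}.$$ Write $i=i_\delta$ for the Kronecker tensor $\delta$, and $i_y,j_y$ for the operators given by a vector $y\in\mathbb R^n=\{\text{real vectors in } S^1\}$. For $0\le k\le m$ define the symmetric tensor field $A^{(m,k)}$ of rank $2m-k$ on $\mathbb R^n\setminus\{0\}$ by $$A^{(m,k)}_{i_1\dots i_{2m-k}}(y)=\frac{\partial^{2m-k}}{\partial y^{i_1}\cdots\partial y^{i_{2m-k}}}\,|y|^{2m-2k-1}.$$ Let $H^{(m,k)}:\mathbb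 R^n\setminus\{0\}\to S^{m-k}$ $(0\le k\le m)$ be given tensor fields. If the system $$A^{(m,k)}(y)/g(y)=H^{(m,k)}(y)\qquad(0\le k\le m,\ y\in\mathbb R^n\setminus\{0\})$$ has a solution $g:\mathbb R^n\setminus\{0\}\to S^m$, then the solution is unique and is expressed by $$g(y)=\frac{|y|}{m!}\sum_{k=0}^m\frac{(-1)^k}{(2m-2k-1)!!}\binom mk\sum_{p=0}^{\min(k,m-k)}\frac{(-1)^p}{2^p}\binom{m-k}{p}\,i^{p}\,i_y^{k-p}\,j_y^{p}\,H^{(m,k)}(y)\qquad(y\ne 0),$$ where $(2l-1)!!=1\cdot3\cdots(2l-1)$ for $l\ge1$ and $(-1)!!=1$. -/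

import Mathlib

/-- `T^m ℝⁿ`: complex `m`-tensors on `ℝⁿ`, given by their components `u_{i₁…i_m}` in the standard
orthonormal basis. -/
abbrev Tensor (n m : ℕ) : Type := (Fin m → Fin n) → ℂ

namespace Tensor

variable {n : ℕ}

/-- Transport along an equality of ranks. -/
def cast {a b : ℕ} (h : a = b) (u : Tensor n a) : Tensor n b :=
  fun i => u (i ∘ Fin.cast h)

/-- Symmetrization `σ` in all indices. -/
noncomputable def symmetrize {m : ℕ} (u : Tensor n m) : Tensor n m :=
  fun i => (m.factorial : ℂ)⁻¹ * ∑ π : Equiv.Perm (Fin m), u (i ∘ π)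

/-- `S^m ℝⁿ`: the subspace of symmetric tensors. -/
def symm (n m : ℕ) : Submodule ℂ (Tensor n m) where
  carrier := {u | ∀ (π : Equiv.Perm (Fin m)) (i : Fin m → Fin n), u (i ∘ π) = u i}
  add_mem' := fun hu hv π i => by simp only [Pi.add_apply, hu π i, hv π i]
  zero_mem' := fun _ _ => rfl
  smul_mem' := fun c u hu π i => by simp only [Pi.smul_apply, hu π i]

/-- The tensor product `v ⊗ u`. -/
def tmul {k r : ℕ} (v : Tensor n k) (u : Tensor n r) : Tensor n (k + r) :=
  fun i => v (i ∘ Fin.castAdd r) * u (i ∘ Fin.natAdd k)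

/-- `i_u`, symmetric multiplication by `u`. The factor `u` is placed in the last `r` slots, which is
immaterial because of the symmetrization. -/
noncomputable def iMul {k r : ℕ} (u : Tensor n r) (v : Tensor n k) : Tensor n (k + r) :=
  symmetrize (tmul v u)

/-- `j_u v = v / u`, the contraction (without complex conjugation) of the last `r` indices of `v`
with `u`: `(v / u)_{i₁…i_k} = v_{i₁…i_k l₁…l_r} u^{l₁…l_r}`. -/
def jContr {k r : ℕ} (u : Tensor n r) (v : Tensor n (k + r)) : Tensor n k :=
  fun i => ∑ l : Fin r → Fin n, v (Fin.append i l) * u l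

/-- The power `i_u^p`. -/
noncomputable def iMulPow {r : ℕ} (u : Tensor n r) :
    (p : ℕ) → {k : ℕ} → Tensor n k → Tensor n (k + r * p)
  | 0, _, v => v
  | p + 1, _, v => cast (by rw [Nat.mul_succ, Nat.add_assoc]) (iMul u (iMulPow u p v))

/-- The power `j_u^p`. -/
def jContrPow {r : ℕ} (u : Tensor n r) :
    (p : ℕ) → {k : ℕ} → Tensor n (k + r * p) → Tensor n k
  | 0, _, v => v
  | p + 1, _, v => jContrPow u p (jContr u (cast (by rw [Nat.mul_succ, Nat.add_assoc]) v))

/-- A vector `y ∈ ℝⁿ` as a tensor of rank one. -/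
def ofVec (y : EuclideanSpace ℝ (Fin n)) : Tensor n 1 := fun i => (y (i 0) : ℂ)

/-- The Kronecker tensor `δ`. -/
def kronecker (n : ℕ) : Tensor n 2 := fun i => if i 0 = i 1 then 1 else 0

end Tensor

/-- `ℝⁿ ∖ {0}`. -/
abbrev PuncturedSpace (n : ℕ) : Type := {y : EuclideanSpace ℝ (Fin n) // y ≠ 0}

/-- The tensor field `A^{(m,k)} = d^{2m-k} |y|^{2m-2k-1}`, i.e.
`A^{(m,k)}_{i₁…i_{2m-k}} = ∂_{i₁…i_{2m-k}} |y|^{2m-2k-1}`. It is used only at points `y ≠ 0`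
and for `k ≤ m`. -/
noncomputable def fieldA (n m k : ℕ) (y : EuclideanSpace ℝ (Fin n)) : Tensor n (2 * m - k) :=
  fun i => ((iteratedFDeriv ℝ (2 * m - k)
    (fun x : EuclideanSpace ℝ (Fin n) => ‖x‖ ^ (2 * (m : ℤ) - 2 * (k : ℤ) - 1)) y
    (fun a => EuclideanSpace.single (i a) (1 : ℝ)) : ℝ) : ℂ)

/-- The symmetric `m`-tensor field `g` on `ℝⁿ ∖ {0}` solves the system
`A^{(m,k)} / g = H^{(m,k)}`, `0 ≤ k ≤ m`. -/
def IsSystemSolution {n m : ℕ}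
    (H : (k : Fin (m + 1)) → PuncturedSpace n → Tensor.symm n (m - k))
    (g : PuncturedSpace n → Tensor.symm n m) : Prop :=
  ∀ (k : Fin (m + 1)) (y : PuncturedSpace n),
    Tensor.jContr (g y : Tensor n m)
      (Tensor.cast (by omega : 2 * m - (k : ℕ) = (m - k) + m) (fieldA n m k y)) =
    (H k y : Tensor n (m - k))

/-! Both sides of the formula are symmetric tensors, so by polarization (`Tensor.ext_of_eval_const`)
it suffices to compare the polynomials they define on the diagonal `(x, …, x)`. There `i` and `i_y`
become multiplication by `|x|²` and `⟨x,y⟩`, `j_y` inserts `y` into a slot, and `A/g` becomes a sum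
of `g_l` times derivatives of powers of the norm in the directions `e_{l₁}, …, e_{l_m}`. The formula
thus reduces to an identity free of `g` and `H`, expressing `∏ ⟨x, w_i⟩` through derivatives of
`|·|^(2m-2k-1)` at `y` (`sum_iteratedFDeriv_append_norm_zpow`).

To prove that identity, fix `d = ⟨x,y⟩` and put `ν(s) = |z + s x|`, `e(s) = d s + |x|² s²/2`, `γ =
⟨x,z⟩ - d`. Then `ν² - 2e = |z|² + 2γs`, so the `m`-th Taylor coefficient of `(ν² - 2e)^(m-1/2) /
(2m-1)‼` at `s = 0` is `γ^m / (m! |z|)`. Expanding in powers of `e = O(s)` instead, only `k ≤ m`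
matters, and the coefficients are directional derivatives of `|z|^(2m-2k-1)` along `x`
(`sum_iteratedFDeriv_norm_zpow`). As functions of `z` both expressions are then differentiated `m`
times at `z = y`, where `γ^m` vanishes to order `m` and leaves exactly `∏ ⟨x, w_i⟩ / |y|`.
Homogeneity of the derivatives of the norm accounts for the contractions with `y`.

Uniqueness follows because the right-hand side involves only `H`. -/

open Filter Topology Finset
open scoped ContDiff

/-! ### Iterated derivatives, Euler's identity, and functions vanishing to order `m`. -/

section Calculus

variable {E : Type*} [NormedAddCommGroup E] [NormedSpace ℝ E]

lemma ContDiffAt.iteratedFDeriv_apply_const {φ : E → ℝ} {z : E} (h : ContDiffAt ℝ ω φ z) {N : ℕ}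
    (v : Fin N → E) : ContDiffAt ℝ ω (fun z => iteratedFDeriv ℝ N φ z v) z :=
  (ContinuousMultilinearMap.apply ℝ (fun _ : Fin N => E) ℝ v).contDiff.contDiffAt.comp z
    (h.iteratedFDeriv_right (m := ω) (by simp))

lemma ContDiffAt.iteratedFDeriv_cons_apply {φ : E → ℝ} {z : E} (h : ContDiffAt ℝ ω φ z) {N : ℕ}
    (w : E) (v : Fin N → E) :
    iteratedFDeriv ℝ (N + 1) φ z (Fin.cons w v) =
      fderiv ℝ (fun z => iteratedFDeriv ℝ N φ z v) z w := by
  rw [(h.differentiableAt_iteratedFDeriv (by simp)).iteratedFDeriv_succ_apply_left']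
  simp

/-- The iterated derivative does not depend on the enumeration of its arguments. -/
lemma ContDiffAt.iteratedFDeriv_comp_equiv {φ : E → ℝ} {z : E} (h : ContDiffAt ℝ ω φ z)
    {M N : ℕ} (σ : Fin M ≃ Fin N) (v : Fin N → E) :
    iteratedFDeriv ℝ M φ z (v ∘ σ) = iteratedFDeriv ℝ N φ z v := by
  obtain rfl : M = N := by simpa using Fintype.card_congr σ
  exact h.iteratedFDeriv_comp_perm v σ

/-- Iterated derivatives compose. -/
lemma ContDiffAt.iteratedFDeriv_append_apply {φ : E → ℝ} {z : E} (h : ContDiffAt ℝ ω φ z)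
    {a b : ℕ} (u : Fin a → E) (v : Fin b → E) :
    iteratedFDeriv ℝ (a + b) φ z (Fin.append u v) =
      iteratedFDeriv ℝ a (fun z => iteratedFDeriv ℝ b φ z v) z u := by
  induction a generalizing z with
  | zero =>
    rw [iteratedFDeriv_zero_apply, ← h.iteratedFDeriv_comp_equiv (finCongr (Nat.zero_add b)) v]
    congr 1
    rw [Subsingleton.elim u Fin.elim0, Fin.elim0_append]
    rfl
  | succ a ih =>
    have hev : (fun z => iteratedFDeriv ℝ (a + b) φ z (Fin.append (Fin.tail u) v)) =ᶠ[𝓝 z]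
        fun z => iteratedFDeriv ℝ a (fun z => iteratedFDeriv ℝ b φ z v) z (Fin.tail u) := by
      filter_upwards [h.eventually (by simp)] with t ht using ih ht _
    have hcast := h.iteratedFDeriv_comp_equiv (finCongr (Nat.succ_add a b))
      (Fin.cons (u 0) (Fin.append (Fin.tail u) v) : Fin (a + b + 1) → E)
    have hu : Fin.append u v =
        (Fin.cons (u 0) (Fin.append (Fin.tail u) v) : Fin (a + b + 1) → E) ∘
          finCongr (Nat.succ_add a b) := by
      conv_lhs => rw [← Fin.cons_self_tail u]
      exact Fin.append_cons _ _ _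
    rw [hu, hcast, h.iteratedFDeriv_cons_apply, hev.fderiv_eq,
      ← (h.iteratedFDeriv_apply_const v).iteratedFDeriv_cons_apply, Fin.cons_self_tail]

/-- Converts Taylor coefficients in `s` along a line into derivatives in the repeated direction `x`.
-/
lemma iteratedDeriv_comp_line {φ : E → ℝ} (x : E) (N : ℕ) (z : E) (s : ℝ)
    (h : ContDiffAt ℝ ω φ (z + s • x)) :
    iteratedDeriv N (fun s => φ (z + s • x)) s =
      iteratedFDeriv ℝ N φ (z + s • x) (fun _ => x) := by
  induction N generalizing s with
  | zero => simp
  | succ N ih =>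
    have hline : HasDerivAt (fun s : ℝ => z + s • x) x s := by
      simpa using ((hasDerivAt_id s).smul_const x).const_add z
    have hev : iteratedDeriv N (fun s => φ (z + s • x)) =ᶠ[𝓝 s]
        fun s => iteratedFDeriv ℝ N φ (z + s • x) (fun _ => x) := by
      filter_upwards [hline.continuousAt.eventually (h.eventually (by simp))] with t ht
      exact ih t ht
    rw [iteratedDeriv_succ, hev.deriv_eq]
    have h1 := ((h.iteratedFDeriv_apply_const (N := N) (fun _ => x)).differentiableAt
      (by simp)).hasFDerivAt.comp_hasDerivAt s hline
    have h2 := h1.deriv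
    simp only [Function.comp_def] at h2
    rw [h2, ← h.iteratedFDeriv_cons_apply]
    congr 1
    ext i
    refine Fin.cases ?_ (fun j => ?_) i <;> simp

lemma ContDiffAt.zpow_of_ne_zero {φ : E → ℝ} {z : E} (h : ContDiffAt ℝ ω φ z) (h0 : φ z ≠ 0)
    (j : ℤ) : ContDiffAt ℝ ω (fun z => φ z ^ j) z := by
  cases j with
  | ofNat j => simpa using h.pow j
  | negSucc j =>
    simp only [zpow_negSucc]
    exact (h.pow (j + 1)).inv (pow_ne_zero _ h0)

/-- A function satisfying Euler's identity of degree `d` away from the origin. -/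
def IsEuler (d : ℝ) (φ : E → ℝ) : Prop :=
  ∀ z, z ≠ 0 → ContDiffAt ℝ ω φ z ∧ fderiv ℝ φ z z = d * φ z

/-- Differentiating Euler's identity in the direction `w` gives `D²φ(w, z) + Dφ(w) = d Dφ(w)`;
symmetry of `D²φ` turns this into Euler's identity for `Dφ(w)`. -/
lemma IsEuler.fderiv_apply {d : ℝ} {φ : E → ℝ} (h : IsEuler d φ) (w : E) :
    IsEuler (d - 1) (fun z => fderiv ℝ φ z w) := by
  intro z hz
  have hφ := (h z hz).1
  have hd : ContDiffAt ℝ ω (fderiv ℝ φ) z := hφ.fderiv_right (by simp)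
  refine ⟨hd.clm_apply contDiffAt_const, ?_⟩
  have hdd := (hd.differentiableAt (by simp)).hasFDerivAt
  have h1 : HasFDerivAt (fun z => fderiv ℝ φ z z) _ z := hdd.clm_apply (hasFDerivAt_id z)
  have h2 : (fun z => fderiv ℝ φ z z) =ᶠ[𝓝 z] fun z => d * φ z := by
    filter_upwards [isOpen_ne.mem_nhds hz] with t ht using (h t ht).2
  have h3 := h2.fderiv_eq (𝕜 := ℝ)
  rw [h1.fderiv, fderiv_const_mul (hφ.differentiableAt (by simp))] at h3
  have h4 := DFunLike.congr_fun h3 w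
  have h5 : HasFDerivAt (fun z => fderiv ℝ φ z w) _ z := hdd.clm_apply (hasFDerivAt_const w z)
  rw [h5.fderiv]
  have h6 := hφ.isSymmSndFDerivAt (by simp) z w
  simp at h4 ⊢
  rw [h6]
  linarith

lemma IsEuler.iteratedFDeriv_apply {d : ℝ} {φ : E → ℝ} (h : IsEuler d φ) {N : ℕ}
    (v : Fin N → E) : IsEuler (d - N) (fun z => iteratedFDeriv ℝ N φ z v) := by
  induction N with
  | zero => simpa using h
  | succ N ih =>
    have h1 := (ih (Fin.tail v)).fderiv_apply (v 0)
    intro z hz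
    have h2 := h1 z hz
    have : (fun z => fderiv ℝ (fun z => iteratedFDeriv ℝ N φ z (Fin.tail v)) z (v 0)) =ᶠ[𝓝 z]
        fun z => iteratedFDeriv ℝ (N + 1) φ z v := by
      filter_upwards [isOpen_ne.mem_nhds hz] with t ht
      rw [← (h t ht).1.iteratedFDeriv_cons_apply, Fin.cons_self_tail]
    rw [this.fderiv_eq, this.self_of_nhds] at h2
    refine ⟨h2.1.congr_of_eventuallyEq this.symm, ?_⟩
    rw [h2.2]; push_cast; ring

lemma IsEuler.iteratedFDeriv_self {d : ℝ} {φ : E → ℝ} (h : IsEuler d φ) (p : ℕ) {y : E}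
    (hy : y ≠ 0) :
    iteratedFDeriv ℝ p φ y (fun _ => y) = (∏ i ∈ range p, (d - i)) * φ y := by
  induction p with
  | zero => simp
  | succ p ih =>
    have : (fun _ : Fin (p + 1) => y) = Fin.cons y (fun _ : Fin p => y) := by
      ext i
      refine Fin.cases ?_ (fun j => ?_) i <;> simp
    rw [this, (h y hy).1.iteratedFDeriv_cons_apply, (h.iteratedFDeriv_apply _ y hy).2,
      prod_range_succ]
    simp only [ih]
    ring

/-- The `m`-th derivative at `y` of a function divisible by the `m`-th power of an affine function
vanishing at `y`. -/
lemma iteratedFDeriv_affine_pow_mul (ℓ : E →L[ℝ] ℝ) (y : E) (m : ℕ) (h : E → ℝ)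
    (hh : ContDiffAt ℝ ω h y) (w : Fin m → E) :
    iteratedFDeriv ℝ m (fun z => (ℓ z - ℓ y) ^ m * h z) y w = (m.factorial : ℝ) * (∏ i, ℓ (w i)) * h y := by
  induction m generalizing h with
  | zero => simp
  | succ m ih =>
    have hF : ContDiffAt ℝ ω (fun z => (ℓ z - ℓ y) ^ (m + 1) * h z) y := by fun_prop
    have hw : w = Fin.append (Fin.init w) (fun _ : Fin 1 => w (Fin.last m)) := by
      rw [Fin.append_right_eq_snoc, Fin.snoc_init_self]
    -- One derivative lowers the power by one and changes the cofactor, which is why `h` is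
    -- arbitrary in the induction. The second summand of the new cofactor vanishes at `y`.
    have hev : (fun z => iteratedFDeriv ℝ 1 (fun z => (ℓ z - ℓ y) ^ (m + 1) * h z) z
          (fun _ : Fin 1 => w (Fin.last m))) =ᶠ[𝓝 y]
        fun z => (ℓ z - ℓ y) ^ m * ((m + 1) * ℓ (w (Fin.last m)) * h z +
          (ℓ z - ℓ y) * fderiv ℝ h z (w (Fin.last m))) := by
      filter_upwards [hh.eventually (by simp)] with z hz
      have h1 := (((ℓ.hasFDerivAt (x := z)).sub_const (ℓ y)).pow (m + 1)).mul
        (hz.differentiableAt (by simp)).hasFDerivAt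
      rw [iteratedFDeriv_one_apply]
      have h2 := h1.fderiv
      simp only [Pi.mul_def] at h2
      rw [h2]
      simp
      ring
    conv_lhs => rw [hw]
    rw [hF.iteratedFDeriv_append_apply, (hev.iteratedFDeriv ℝ m).self_of_nhds, ih,
      Fin.prod_univ_castSucc, Nat.factorial_succ]
    · simp only [sub_self, zero_mul, add_zero, Fin.init]
      push_cast
      ring
    · have : ContDiffAt ℝ ω (fderiv ℝ h) y := hh.fderiv_right (by simp)
      fun_prop

end Calculus

/-! ### Calculus of Taylor coefficients in one variable. -/

section TaylorCoefficients

/-- The `m`-th Taylor coefficient at the origin. -/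
noncomputable def taylorCoeff (m : ℕ) (f : ℝ → ℝ) : ℝ := iteratedDeriv m f 0 / m.factorial

lemma taylorCoeff_congr {f g : ℝ → ℝ} (h : f =ᶠ[𝓝 0] g) (m : ℕ) :
    taylorCoeff m f = taylorCoeff m g := by
  rw [taylorCoeff, taylorCoeff, (h.iteratedDeriv m).self_of_nhds]

lemma taylorCoeff_add {f g : ℝ → ℝ} (hf : ContDiffAt ℝ ω f 0) (hg : ContDiffAt ℝ ω g 0) (m : ℕ) :
    taylorCoeff m (fun s => f s + g s) = taylorCoeff m f + taylorCoeff m g := by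
  rw [taylorCoeff, iteratedDeriv_fun_add (hf.of_le (by simp)) (hg.of_le (by simp)), add_div]
  rfl

lemma taylorCoeff_const_mul (c : ℝ) (f : ℝ → ℝ) (m : ℕ) :
    taylorCoeff m (fun s => c * f s) = c * taylorCoeff m f := by
  simp [taylorCoeff, mul_div_assoc]

lemma taylorCoeff_sum {ι : Type*} (I : Finset ι) {f : ι → ℝ → ℝ}
    (hf : ∀ i ∈ I, ContDiffAt ℝ ω (f i) 0) (m : ℕ) :
    taylorCoeff m (fun s => ∑ i ∈ I, f i s) = ∑ i ∈ I, taylorCoeff m (f i) := by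
  rw [taylorCoeff, iteratedDeriv_fun_sum fun i hi => (hf i hi).of_le (by simp), sum_div]
  rfl

lemma taylorCoeff_deriv (f : ℝ → ℝ) (m : ℕ) :
    taylorCoeff m (deriv f) = (m + 1) * taylorCoeff (m + 1) f := by
  rw [taylorCoeff, taylorCoeff, iteratedDeriv_succ', Nat.factorial_succ]
  push_cast
  field_simp

lemma contDiffAt_deriv {f : ℝ → ℝ} {s : ℝ} (hf : ContDiffAt ℝ ω f s) :
    ContDiffAt ℝ ω (deriv f) s := by
  have h : ContDiffAt ℝ ω (fderiv ℝ f) s := hf.fderiv_right (by simp)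
  exact h.clm_apply contDiffAt_const

/-- Induction through `(s f)' = f + s f'`, after multiplying by `m + 1` so that `taylorCoeff_deriv`
applies. -/
lemma taylorCoeff_id_mul {f : ℝ → ℝ} (hf : ContDiffAt ℝ ω f 0) (m : ℕ) :
    taylorCoeff (m + 1) (fun s => s * f s) = taylorCoeff m f := by
  have key : (m + 1 : ℝ) * taylorCoeff (m + 1) (fun s => s * f s) = (m + 1) * taylorCoeff m f := by
    induction m generalizing f with
    | zero =>
      rw [← Nat.cast_zero, ← taylorCoeff_deriv]
      have h := (hasDerivAt_id (0 : ℝ)).mul (hf.differentiableAt (by simp)).hasDerivAt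
      have h' := h.deriv
      simp [Pi.mul_def] at h'
      simp [taylorCoeff, h']
    | succ m ih =>
      have hd := contDiffAt_deriv hf
      have hev : deriv (fun s => s * f s) =ᶠ[𝓝 0] fun s => f s + s * deriv f s := by
        filter_upwards [hf.eventually (by simp)] with s hs
        have h := (hasDerivAt_id s).mul (hs.differentiableAt (by simp)).hasDerivAt
        simpa [Pi.mul_def] using h.deriv
      have h0 : (m + 1 : ℝ) ≠ 0 := by positivity
      rw [← taylorCoeff_deriv, taylorCoeff_congr hev,
        taylorCoeff_add hf (by fun_prop), mul_left_cancel₀ h0 (ih hd), taylorCoeff_deriv]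
      push_cast
      ring
  exact mul_left_cancel₀ (by positivity) key

lemma taylorCoeff_pow_mul {f : ℝ → ℝ} (hf : ContDiffAt ℝ ω f 0) (m j : ℕ) :
    taylorCoeff m (fun s => s ^ j * f s) = if j ≤ m then taylorCoeff (m - j) f else 0 := by
  induction j generalizing m with
  | zero => simp
  | succ j ih =>
    simp only [pow_succ', mul_assoc]
    cases m with
    | zero => simp [taylorCoeff]
    | succ m =>
      rw [taylorCoeff_id_mul (by fun_prop), ih]
      simp

end TaylorCoefficients

/-! ### Expansion of `(ν² - 2e)^(m-1/2)` without half-integer powers. -/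

section SquareRootOfQuadratic

/-- The coefficients of `normPowSum`. -/
noncomputable def normPowCoeff (m k : ℕ) : ℝ :=
  (-1) ^ k / (k.factorial * (Nat.doubleFactorial (2 * (m - k) - 1) : ℝ))

lemma normPowCoeff_succ_mul {m k : ℕ} (hk : k ≤ m) :
    normPowCoeff (m + 1) k * ((2 * (m + 1 : ℕ) - 2 * k - 1 : ℤ) : ℝ) = normPowCoeff m k := by
  obtain ⟨j, rfl⟩ := Nat.exists_eq_add_of_le hk
  have h1 : 2 * (k + j + 1 - k) - 1 = 2 * j + 1 := by omega
  have h2 : 2 * (k + j - k) - 1 = 2 * j - 1 := by omega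
  have h3 : ((2 * j - 1).doubleFactorial : ℝ) ≠ 0 := by
    exact_mod_cast (Nat.doubleFactorial_pos _).ne'
  -- For `j = 0` the truncated `2 * j - 1` is `0`, and `0‼ = 1` agrees with the convention `(-1)‼ =
  -- 1`.
  rw [normPowCoeff, normPowCoeff, h1, h2, Nat.doubleFactorial_add_one]
  push_cast
  have h4 : (2 * j + 1 : ℝ) ≠ 0 := by positivity
  field_simp
  ring

lemma normPowCoeff_succ_succ (m k : ℕ) :
    normPowCoeff (m + 1) (k + 1) * (k + 1) = -normPowCoeff m k := by
  have h3 : ((2 * (m - k) - 1).doubleFactorial : ℝ) ≠ 0 := by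
    exact_mod_cast (Nat.doubleFactorial_pos _).ne'
  rw [normPowCoeff, normPowCoeff, Nat.factorial_succ, Nat.add_sub_add_right]
  push_cast
  field_simp
  ring

/-- A truncated Taylor expansion of `(ν² - 2 e) ^ (m - 1 / 2) / (2 m - 1)‼` in powers of `e`. -/
noncomputable def normPowSum (m : ℕ) (e ν : ℝ) : ℝ :=
  ∑ k ∈ range (m + 1), normPowCoeff m k * (e ^ k * ν ^ (2 * (m : ℤ) - 2 * (k : ℤ) - 1))

/-- The hypothesis on `ν'` says `(ν² - 2e)' = 2γ`. The untruncated power would have derivative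
exactly `γ` times the one for `m`; truncation leaves one extra term, divisible by `e^(m+1)`. -/
lemma hasDerivAt_normPowSum {m : ℕ} {e ν : ℝ → ℝ} {e' γ s : ℝ} (he : HasDerivAt e e' s)
    (hν : HasDerivAt ν ((e' + γ) / ν s) s) (h0 : ν s ≠ 0) :
    HasDerivAt (fun s => normPowSum (m + 1) (e s) (ν s))
      (γ * normPowSum m (e s) (ν s) -
        normPowCoeff (m + 1) (m + 1) * (e s ^ (m + 1) * ((e' + γ) * ν s ^ (-3 : ℤ)))) s := by
  have hterm : ∀ k ∈ range (m + 1 + 1), HasDerivAt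
      (fun s => normPowCoeff (m + 1) k *
        (e s ^ k * ν s ^ (2 * ((m + 1 : ℕ) : ℤ) - 2 * (k : ℤ) - 1)))
      (normPowCoeff (m + 1) k * (k * e s ^ (k - 1) * e' *
          ν s ^ (2 * ((m + 1 : ℕ) : ℤ) - 2 * (k : ℤ) - 1)) +
        normPowCoeff (m + 1) k * ((2 * (m + 1 : ℕ) - 2 * k - 1 : ℤ) : ℝ) *
          (e s ^ k * ((e' + γ) * ν s ^ (2 * (m : ℤ) - 2 * (k : ℤ) - 1)))) s := by
    intro k _
    have hz := (hasDerivAt_zpow (2 * ((m + 1 : ℕ) : ℤ) - 2 * (k : ℤ) - 1) (ν s) (Or.inl h0)).comp s hν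
    convert! ((he.pow k).mul hz).const_mul (normPowCoeff (m + 1) k) using 1
    have : 2 * ((m + 1 : ℕ) : ℤ) - 2 * (k : ℤ) - 1 - 1 = (2 * (m : ℤ) - 2 * (k : ℤ) - 1) + 1 := by
      push_cast; ring
    rw [this, zpow_add_one₀ h0]
    simp only [Function.comp_apply, Pi.pow_apply]
    field_simp
  refine (HasDerivAt.fun_sum hterm).congr_deriv ?_
  -- The terms from differentiating `e ^ k`, shifted by one index, cancel the `e'` part of the terms
  -- from differentiating the powers of `ν`. The top term of the latter has no partner.
  rw [sum_add_distrib, sum_range_succ' (fun k => normPowCoeff (m + 1) k * _) (m + 1),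
    sum_range_succ _ (m + 1)]
  have h1 : ∑ k ∈ range (m + 1), normPowCoeff (m + 1) (k + 1) * (((k + 1 : ℕ) : ℝ) *
      e s ^ (k + 1 - 1) * e' * ν s ^ (2 * ((m + 1 : ℕ) : ℤ) - 2 * ((k + 1 : ℕ) : ℤ) - 1)) =
      -e' * normPowSum m (e s) (ν s) := by
    rw [normPowSum, mul_sum]
    refine sum_congr rfl fun k _ => ?_
    have h := normPowCoeff_succ_succ m k
    have h' : 2 * ((m + 1 : ℕ) : ℤ) - 2 * ((k + 1 : ℕ) : ℤ) - 1 = 2 * (m : ℤ) - 2 * k - 1 := by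
      push_cast; ring
    rw [h', Nat.add_sub_cancel]
    push_cast
    linear_combination e s ^ k * e' * ν s ^ (2 * (m : ℤ) - 2 * k - 1) * h
  have h2 : ∑ k ∈ range (m + 1), normPowCoeff (m + 1) k *
      ((2 * (m + 1 : ℕ) - 2 * k - 1 : ℤ) : ℝ) *
        (e s ^ k * ((e' + γ) * ν s ^ (2 * (m : ℤ) - 2 * (k : ℤ) - 1))) =
      (e' + γ) * normPowSum m (e s) (ν s) := by
    rw [normPowSum, mul_sum]
    refine sum_congr rfl fun k hk => ?_
    rw [normPowCoeff_succ_mul (Nat.lt_succ_iff.1 (mem_range.1 hk))]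
    ring
  rw [h1, h2]
  have h3 : 2 * (m : ℤ) - 2 * ((m + 1 : ℕ) : ℤ) - 1 = -3 := by push_cast; ring
  rw [h3]
  push_cast
  simp
  ring

variable {ν : ℝ → ℝ} {α d f γ : ℝ}

lemma contDiffAt_normPowSum (hν : ContDiffAt ℝ ω ν 0) (h0 : ν 0 ≠ 0) {e : ℝ → ℝ}
    (he : ContDiffAt ℝ ω e 0) (m : ℕ) :
    ContDiffAt ℝ ω (fun s => normPowSum m (e s) (ν s)) 0 := by
  refine ContDiffAt.sum fun k _ => ?_
  have := hν.zpow_of_ne_zero h0 (2 * (m : ℤ) - 2 * (k : ℤ) - 1)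
  fun_prop

/-- If `ν² - 2 e` is affine with slope `2 γ`, where `e = d s + f s² / 2`, then the `m`-th Taylor
coefficient of `normPowSum m e ν` is that of `(ν² - 2 e) ^ (m - 1 / 2) / (2 m - 1)‼`. -/
lemma taylorCoeff_normPowSum (hν : ContDiffAt ℝ ω ν 0) (h0 : ν 0 ≠ 0)
    (hq : ∀ᶠ s in 𝓝 0, ν s ^ 2 = α + 2 * (d + γ) * s + f * s ^ 2) (m : ℕ) :
    taylorCoeff m (fun s => normPowSum m (s * (d + f / 2 * s)) (ν s)) =
      γ ^ m / m.factorial * (ν 0)⁻¹ := by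
  induction m with
  | zero => simp [taylorCoeff, normPowSum, normPowCoeff]
  | succ m ih =>
    have hz := hν.zpow_of_ne_zero h0 (-3)
    -- Since `e` is divisible by `s`, the truncation error carries `s ^ (m + 1)` and does not affect
    -- the `m`-th coefficient.
    have hev : deriv (fun s => normPowSum (m + 1) (s * (d + f / 2 * s)) (ν s)) =ᶠ[𝓝 0]
        fun s => γ * normPowSum m (s * (d + f / 2 * s)) (ν s) +
          s ^ (m + 1) * (-normPowCoeff (m + 1) (m + 1) * (d + f / 2 * s) ^ (m + 1) *
            ((d + f * s + γ) * ν s ^ (-3 : ℤ))) := by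
      filter_upwards [hν.eventually (by simp), hν.continuousAt.eventually_ne h0,
        eventually_eventually_nhds.2 hq] with s hs hs0 hqs
      have he : HasDerivAt (fun s : ℝ => s * (d + f / 2 * s)) (d + f * s) s := by
        convert! (hasDerivAt_id s).mul (((hasDerivAt_id s).const_mul (f / 2)).const_add d) using 1
        simp; ring
      have hνd := (hs.differentiableAt (by simp)).hasDerivAt
      have hsq : HasDerivAt (fun s : ℝ => α + 2 * (d + γ) * s + f * s ^ 2)
          (2 * (d + γ) + f * (2 * s)) s := by
        convert! (((hasDerivAt_id s).const_mul (2 * (d + γ))).const_add α).add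
          (((hasDerivAt_id s).pow 2).const_mul f) using 1
        simp
      have hdν : deriv ν s = (d + f * s + γ) / ν s := by
        have h1 := (hνd.pow 2).deriv
        have h2 : deriv (ν ^ 2) s = 2 * (d + γ) + f * (2 * s) := by
          rw [← hsq.deriv]
          exact EventuallyEq.deriv_eq hqs
        rw [h2] at h1
        rw [eq_div_iff hs0]
        simp at h1
        linarith
      rw [hdν] at hνd
      rw [(hasDerivAt_normPowSum he hνd hs0).deriv, mul_pow]
      ring
    have hs := contDiffAt_normPowSum hν h0 (e := fun s => s * (d + f / 2 * s)) (by fun_prop) m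
    have h1 : (m + 1 : ℝ) * taylorCoeff (m + 1)
        (fun s => normPowSum (m + 1) (s * (d + f / 2 * s)) (ν s)) =
        γ * (γ ^ m / m.factorial * (ν 0)⁻¹) := by
      rw [← taylorCoeff_deriv, taylorCoeff_congr hev, taylorCoeff_add (by fun_prop) (by fun_prop),
        taylorCoeff_const_mul, ih, taylorCoeff_pow_mul (by fun_prop)]
      simp
    rw [Nat.factorial_succ]
    push_cast
    have h2 : (m + 1 : ℝ) ≠ 0 := by positivity
    rw [eq_comm, ← mul_right_inj' h2, h1]
    field_simp
    ring

/-- Obtained by expanding `e ^ k = s ^ k (d + f s / 2) ^ k` binomially. -/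
lemma sum_taylorCoeff_zpow (hν : ContDiffAt ℝ ω ν 0) (h0 : ν 0 ≠ 0)
    (hq : ∀ᶠ s in 𝓝 0, ν s ^ 2 = α + 2 * (d + γ) * s + f * s ^ 2) (m : ℕ) :
    ∑ k ∈ range (m + 1), normPowCoeff m k * ∑ p ∈ range (min k (m - k) + 1),
      k.choose p * (f / 2) ^ p * d ^ (k - p) *
        taylorCoeff (m - k - p) (fun s => ν s ^ (2 * (m : ℤ) - 2 * (k : ℤ) - 1)) =
      γ ^ m / m.factorial * (ν 0)⁻¹ := by
  rw [← taylorCoeff_normPowSum hν h0 hq m]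
  have hz : ∀ k : ℕ, ContDiffAt ℝ ω (fun s => ν s ^ (2 * (m : ℤ) - 2 * (k : ℤ) - 1)) 0 :=
    fun k => hν.zpow_of_ne_zero h0 _
  simp only [normPowSum]
  rw [taylorCoeff_sum _ fun k _ => by have := hz k; fun_prop]
  refine sum_congr rfl fun k hk => ?_
  rw [taylorCoeff_const_mul]
  congr 1
  have hexp : (fun s => (s * (d + f / 2 * s)) ^ k * ν s ^ (2 * (m : ℤ) - 2 * (k : ℤ) - 1)) =
      fun s => ∑ p ∈ range (k + 1), k.choose p * (f / 2) ^ p * d ^ (k - p) *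
        (s ^ (k + p) * ν s ^ (2 * (m : ℤ) - 2 * (k : ℤ) - 1)) := by
    ext s
    rw [mul_pow, add_comm d, add_pow, mul_sum, sum_mul]
    refine sum_congr rfl fun p _ => ?_
    rw [mul_pow, pow_add]
    ring
  rw [hexp, taylorCoeff_sum _ fun p _ => by have := hz k; fun_prop]
  rw [mem_range] at hk
  -- The factor `s ^ (k + p)` kills the `m`-th coefficient unless `p ≤ m - k`; this is the origin of
  -- `min k (m - k)`.
  refine sum_subset_zero_on_sdiff (range_subset_range.2 (by omega)) ?_ ?_
  · intro p hp
    simp only [Finset.mem_sdiff, mem_range] at hp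
    rw [taylorCoeff_const_mul, taylorCoeff_pow_mul (hz k), if_neg (by omega), mul_zero]
  · intro p hp
    rw [mem_range] at hp
    rw [taylorCoeff_const_mul, taylorCoeff_pow_mul (hz k), if_pos (by omega), Nat.sub_sub]

end SquareRootOfQuadratic

/-! ### Derivatives of powers of the norm. -/

section NormPowers

variable {E : Type*} [NormedAddCommGroup E] [InnerProductSpace ℝ E]

lemma isEuler_norm_zpow (j : ℤ) : IsEuler (j : ℝ) (fun z : E => ‖z‖ ^ j) := by
  intro z hz
  have hn : ContDiffAt ℝ ω (fun z : E => ‖z‖) z := contDiffAt_norm ℝ hz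
  have h0 : ‖z‖ ≠ 0 := norm_ne_zero_iff.2 hz
  refine ⟨hn.zpow_of_ne_zero h0 j, ?_⟩
  have hd := hn.differentiableAt (by simp)
  have h := (hasDerivAt_zpow j ‖z‖ (Or.inl h0)).comp_hasFDerivAt z hd.hasFDerivAt
  have h' := h.fderiv
  simp only [Function.comp_def] at h'
  rw [h']
  simp only [_root_.smul_apply, smul_eq_mul, hd.fderiv_norm_self]
  rw [mul_assoc, ← zpow_add_one₀ h0, sub_add_cancel]

/-- By `hj` the `M`-th derivative is homogeneous of degree `p - k - 1`, so `p` contractions with `y`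
produce `(p-k-1)(p-k-2)⋯(-k)`. Read backwards, this is `(-1)^p k(k-1)⋯(k-p+1)`. -/
lemma iteratedFDeriv_norm_zpow_self {j : ℤ} {k p M : ℕ} (hj : j - M = p - k - 1) {y : E}
    (hy : y ≠ 0) (v : Fin M → E) :
    iteratedFDeriv ℝ (p + M) (fun z : E => ‖z‖ ^ j) y (Fin.append (fun _ => y) v) =
      (-1) ^ p * k.descFactorial p * iteratedFDeriv ℝ M (fun z : E => ‖z‖ ^ j) y v := by
  have hE := isEuler_norm_zpow (E := E) j
  rw [(hE y hy).1.iteratedFDeriv_append_apply, (hE.iteratedFDeriv_apply v).iteratedFDeriv_self p hy]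
  congr 1
  have hj' : (j : ℝ) - M = p - k - 1 := by exact_mod_cast hj
  rw [hj', ← prod_range_reflect]
  have : ∀ i ∈ range p, (p - k - 1 - (p - 1 - i : ℕ) : ℝ) = -1 * (k - i) := by
    intro i hi
    rw [mem_range] at hi
    rw [Nat.cast_sub (by omega), Nat.cast_sub (by omega)]
    push_cast
    ring
  rw [prod_congr rfl this, prod_mul_distrib, prod_const, card_range]
  congr 1
  rw [Nat.descFactorial_eq_prod_range]
  by_cases hpk : p ≤ k
  · push_cast
    refine prod_congr rfl fun i hi => ?_
    rw [mem_range] at hi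
    rw [Nat.cast_sub (by omega)]
  · push Not at hpk
    rw [prod_eq_zero (mem_range.2 hpk) (sub_self _), prod_eq_zero (mem_range.2 hpk) (Nat.sub_self _)]
    simp

/-- `|z + s x|²` is quadratic in `s`. The parameter `d` is independent of `z`, so that it can be
frozen at `⟨x,y⟩` while `z` is differentiated. -/
lemma sum_iteratedFDeriv_norm_zpow (m : ℕ) (d : ℝ) (x : E) {z : E} (hz : z ≠ 0) :
    ∑ k ∈ range (m + 1), ∑ p ∈ range (min k (m - k) + 1),
      (normPowCoeff m k * (k.choose p * (‖x‖ ^ 2 / 2) ^ p * d ^ (k - p)) /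
        (m - k - p).factorial) *
        iteratedFDeriv ℝ (m - k - p) (fun z : E => ‖z‖ ^ (2 * (m : ℤ) - 2 * (k : ℤ) - 1)) z
          (fun _ => x) =
      (inner ℝ x z - d) ^ m * ((m.factorial : ℝ)⁻¹ * ‖z‖⁻¹) := by
  have hν : ContDiffAt ℝ ω (fun s : ℝ => ‖z + s • x‖) 0 := by
    refine ContDiffAt.norm ℝ (by fun_prop) (by simpa using hz)
  have h0 : ‖z + (0 : ℝ) • x‖ ≠ 0 := by simpa using hz
  have h := sum_taylorCoeff_zpow (ν := fun s : ℝ => ‖z + s • x‖) (α := ‖z‖ ^ 2) (d := d)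
    (f := ‖x‖ ^ 2) (γ := inner ℝ x z - d) hν h0 (Eventually.of_forall fun s => by
      rw [norm_add_sq_real, norm_smul, inner_smul_right, mul_pow, Real.norm_eq_abs, sq_abs,
        real_inner_comm]
      ring) m
  simp only [zero_smul, add_zero] at h
  rw [← mul_assoc, ← div_eq_mul_inv ((inner ℝ x z - d) ^ m), ← h]
  refine sum_congr rfl fun k _ => ?_
  rw [mul_sum]
  refine sum_congr rfl fun p _ => ?_
  have hφ := (isEuler_norm_zpow (E := E) (2 * (m : ℤ) - 2 * (k : ℤ) - 1) z hz).1
  have hl := iteratedDeriv_comp_line (φ := fun z : E => ‖z‖ ^ (2 * (m : ℤ) - 2 * (k : ℤ) - 1))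
    x (m - k - p) z 0 (by simpa using hφ)
  rw [taylorCoeff, hl]
  simp only [zero_smul, add_zero]
  ring

/-- The derivatives of the powers of the norm that enter the system, combined so as to isolate
the contraction with `x ⊗ ⋯ ⊗ x`. -/
lemma sum_iteratedFDeriv_append_norm_zpow (m : ℕ) (x : E) {y : E} (hy : y ≠ 0) (w : Fin m → E) :
    ‖y‖ / m.factorial * ∑ k ∈ range (m + 1),
      ((-1) ^ k / (Nat.doubleFactorial (2 * (m - k) - 1) : ℝ) * m.choose k) *
        ∑ p ∈ range (min k (m - k) + 1), ((-1) ^ p / 2 ^ p * (m - k).choose p) *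
          ((‖x‖ ^ 2) ^ p * (inner ℝ x y) ^ (k - p) *
            iteratedFDeriv ℝ (p + (m + (m - k - p)))
              (fun z : E => ‖z‖ ^ (2 * (m : ℤ) - 2 * (k : ℤ) - 1)) y
              (Fin.append (fun _ => y) (Fin.append w (fun _ => x)))) =
      ∏ i, inner ℝ x (w i) := by
  have hφ := fun (k : ℕ) {z : E} (hz : z ≠ 0) =>
    (isEuler_norm_zpow (E := E) (2 * (m : ℤ) - 2 * (k : ℤ) - 1) z hz).1
  have hy0 : ‖y‖ ≠ 0 := norm_ne_zero_iff.2 hy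
  have hev : (fun z : E => ∑ k ∈ range (m + 1), ∑ p ∈ range (min k (m - k) + 1),
      (normPowCoeff m k * (k.choose p * (‖x‖ ^ 2 / 2) ^ p * (inner ℝ x y) ^ (k - p)) /
        (m - k - p).factorial) •
        iteratedFDeriv ℝ (m - k - p) (fun z : E => ‖z‖ ^ (2 * (m : ℤ) - 2 * (k : ℤ) - 1)) z
          (fun _ => x)) =ᶠ[𝓝 y]
      fun z => (innerSL ℝ x z - innerSL ℝ x y) ^ m * ((m.factorial : ℝ)⁻¹ * ‖z‖⁻¹) := by
    filter_upwards [isOpen_ne.mem_nhds hy] with z hz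
    simpa using sum_iteratedFDeriv_norm_zpow m (inner ℝ x y) x hz
  have h := DFunLike.congr_fun (hev.iteratedFDeriv ℝ m).self_of_nhds w
  have hn : ContDiffAt ℝ ω (fun z : E => (m.factorial : ℝ)⁻¹ * ‖z‖⁻¹) y := by
    have := (contDiffAt_norm ℝ hy (n := ω)).inv hy0
    exact contDiffAt_const.mul this
  -- On the right the `m`-th power of `⟨x, z - y⟩` absorbs all `m` derivatives; on the left the
  -- coefficients are constant in `z`.
  rw [iteratedFDeriv_affine_pow_mul _ _ _ _ hn, iteratedFDeriv_fun_sum_apply (fun k _ =>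
    ContDiffAt.sum fun p _ => (((hφ k hy).iteratedFDeriv_apply_const _).const_smul _).of_le
      (by simp)), _root_.sum_apply] at h
  have hm : (m.factorial : ℝ) ≠ 0 := by positivity
  have hfin : ‖y‖ * (m.factorial * (∏ i, innerSL ℝ x (w i)) * ((m.factorial : ℝ)⁻¹ * ‖y‖⁻¹)) =
      ∏ i, inner ℝ x (w i) := by
    simp only [innerSL_apply_apply]
    field_simp
  rw [← hfin, ← h, mul_sum, mul_sum]
  refine sum_congr rfl fun k hk => ?_
  rw [iteratedFDeriv_fun_sum_apply (fun p _ =>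
    (((hφ k hy).iteratedFDeriv_apply_const _).const_smul _).of_le (by simp)),
    _root_.sum_apply, mul_sum, mul_sum, mul_sum]
  refine sum_congr rfl fun p hp => ?_
  rw [mem_range] at hk hp
  rw [iteratedFDeriv_const_smul_apply'
    (((hφ k hy).iteratedFDeriv_apply_const _).of_le (by simp)),
    iteratedFDeriv_norm_zpow_self (k := k) (by omega) hy, (hφ k hy).iteratedFDeriv_append_apply]
  obtain ⟨l, rfl⟩ := Nat.exists_eq_add_of_le (Nat.lt_succ_iff.1 hk)
  obtain ⟨a, rfl⟩ := Nat.exists_eq_add_of_le (show p ≤ l by omega)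
  have e1 : k + (p + a) - k = p + a := by omega
  have e2 : p + a - p = a := by omega
  -- With `m = k + p + a`, both sides carry the factorials `1 / (p! (k - p)! a!)`; the sign `(-1)^p`
  -- of the formula cancels that of the contraction with `y`.
  rw [normPowCoeff, e1, e2, Nat.cast_add_choose, Nat.cast_add_choose,
    Nat.descFactorial_eq_factorial_mul_choose]
  simp only [_root_.smul_apply, smul_eq_mul, Nat.cast_mul, div_pow]
  have h3 : ((2 * (p + a) - 1).doubleFactorial : ℝ) ≠ 0 := by
    exact_mod_cast (Nat.doubleFactorial_pos _).ne'
  have h4 : ((-1 : ℝ) ^ p) ^ 2 = 1 := by rw [← pow_mul, mul_comm, pow_mul]; simp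
  field_simp
  rw [h4]
  ring

end NormPowers

/-! ### Tensors as multilinear forms, and polarization. -/

namespace Tensor

variable {n : ℕ}

/-- The complex multilinear form with components `u`, evaluated at real vectors. -/
noncomputable def eval {r : ℕ} (u : Tensor n r) (v : Fin r → EuclideanSpace ℝ (Fin n)) : ℂ :=
  ∑ i, u i * ∏ a, (v a (i a) : ℂ)

lemma eval_smul {r : ℕ} (c : ℂ) (u : Tensor n r) (v : Fin r → EuclideanSpace ℝ (Fin n)) :
    eval (c • u) v = c * eval u v := by
  simp [eval, mul_sum, mul_assoc]

lemma eval_sum {r : ℕ} {ι : Type*} (I : Finset ι) (u : ι → Tensor n r)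
    (v : Fin r → EuclideanSpace ℝ (Fin n)) :
    eval (∑ j ∈ I, u j) v = ∑ j ∈ I, eval (u j) v := by
  simp only [eval, Finset.sum_apply, sum_mul]
  rw [sum_comm]

lemma eval_cast {a b : ℕ} (h : a = b) (u : Tensor n a) (v : Fin b → EuclideanSpace ℝ (Fin n)) :
    eval (cast h u) v = eval u (v ∘ Fin.cast h) := by
  subst h
  rfl

lemma eval_append {k r : ℕ} (t : Tensor n (k + r)) (v : Fin k → EuclideanSpace ℝ (Fin n))
    (w : Fin r → EuclideanSpace ℝ (Fin n)) :
    eval t (Fin.append v w) = ∑ i : Fin k → Fin n, ∑ l : Fin r → Fin n,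
      t (Fin.append i l) * ((∏ a, (v a (i a) : ℂ)) * ∏ a, (w a (l a) : ℂ)) := by
  rw [eval, ← (Fin.appendEquiv k r).sum_comp, Fintype.sum_prod_type]
  simp [Fin.prod_univ_add, Fin.appendEquiv]

lemma eval_tmul {k r : ℕ} (v : Tensor n k) (u : Tensor n r) (x : EuclideanSpace ℝ (Fin n)) :
    eval (tmul v u) (fun _ => x) = eval v (fun _ => x) * eval u (fun _ => x) := by
  have hx : (fun _ : Fin (k + r) => x) = Fin.append (fun _ => x) (fun _ => x) := by
    ext1 a
    refine Fin.addCases (fun a => ?_) (fun a => ?_) a <;> simp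
  rw [hx, eval_append, eval, eval, sum_mul_sum]
  refine sum_congr rfl fun i _ => sum_congr rfl fun l _ => ?_
  have h1 : Fin.append i l ∘ Fin.castAdd r = i := by ext1 a; simp
  have h2 : Fin.append i l ∘ Fin.natAdd k = l := by ext1 a; simp
  rw [tmul, h1, h2]
  ring

/-- Permuting equal arguments changes nothing, so on the diagonal symmetric multiplication becomes a
product of numbers. -/
lemma eval_symmetrize {r : ℕ} (u : Tensor n r) (x : EuclideanSpace ℝ (Fin n)) :
    eval (symmetrize u) (fun _ => x) = eval u (fun _ => x) := by
  have h : ∀ π : Equiv.Perm (Fin r),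
      ∑ i : Fin r → Fin n, u (i ∘ π) * ∏ a, (x (i a) : ℂ) = eval u (fun _ => x) := by
    intro π
    refine Fintype.sum_equiv (Equiv.arrowCongr π.symm (Equiv.refl (Fin n))) _ _ fun i => ?_
    refine congrArg (u (i ∘ π) * ·) ?_
    exact (Equiv.prod_comp π fun a => (x (i a) : ℂ)).symm
  simp only [symmetrize, eval, mul_assoc, sum_mul]
  rw [← mul_sum, sum_comm, sum_congr rfl fun π _ => h π]
  have : (r.factorial : ℂ) ≠ 0 := by exact_mod_cast r.factorial_ne_zero
  simp [Fintype.card_perm, eval, this]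

lemma eval_iMulPow {k r : ℕ} (u : Tensor n r) (p : ℕ) (v : Tensor n k)
    (x : EuclideanSpace ℝ (Fin n)) :
    eval (iMulPow u p v) (fun _ => x) = eval u (fun _ => x) ^ p * eval v (fun _ => x) := by
  induction p with
  | zero => simp [iMulPow]
  | succ p ih =>
    rw [iMulPow, eval_cast]
    change eval (symmetrize (tmul _ u)) (fun _ => x) = _
    rw [eval_symmetrize, eval_tmul, ih]
    ring

lemma eval_ofVec (x y : EuclideanSpace ℝ (Fin n)) :
    eval (ofVec y) (fun _ => x) = (inner ℝ x y : ℝ) := by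
  rw [eval, ← (Equiv.funUnique (Fin 1) (Fin n)).symm.sum_comp]
  simp [ofVec, PiLp.inner_apply]

lemma eval_kronecker (x : EuclideanSpace ℝ (Fin n)) :
    eval (kronecker n) (fun _ => x) = ((‖x‖ ^ 2 : ℝ) : ℂ) := by
  rw [eval, ← (finTwoArrowEquiv (Fin n)).symm.sum_comp, Fintype.sum_prod_type]
  rw [EuclideanSpace.real_norm_sq_eq]
  simp [kronecker, sq]

lemma eval_jContr {k r : ℕ} (u : Tensor n r) (t : Tensor n (k + r))
    (v : Fin k → EuclideanSpace ℝ (Fin n)) :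
    eval (jContr u t) v =
      ∑ l, u l * eval t (Fin.append v fun a => EuclideanSpace.single (l a) (1 : ℝ)) := by
  have h : ∀ l : Fin r → Fin n, eval t (Fin.append v fun a => EuclideanSpace.single (l a) (1 : ℝ)) =
      ∑ i, t (Fin.append i l) * ∏ a, (v a (i a) : ℂ) := by
    intro l
    rw [eval_append]
    refine sum_congr rfl fun i _ => ?_
    rw [sum_eq_single l]
    · simp
    · intro l' _ hl'
      obtain ⟨a, ha⟩ := Function.ne_iff.1 hl'
      rw [prod_eq_zero (mem_univ a) (by simp [ha])]
      simp
    · simp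
  simp only [h, mul_sum]
  rw [sum_comm]
  refine sum_congr rfl fun i _ => ?_
  rw [jContr, sum_mul]
  refine sum_congr rfl fun l _ => ?_
  ring

lemma eval_jContr_ofVec {k : ℕ} (y : EuclideanSpace ℝ (Fin n)) (t : Tensor n (k + 1))
    (v : Fin k → EuclideanSpace ℝ (Fin n)) :
    eval (jContr (ofVec y) t) v = eval t (Fin.append v fun _ => y) := by
  rw [eval_append]
  refine sum_congr rfl fun i _ => ?_
  rw [jContr, sum_mul]
  refine sum_congr rfl fun l _ => ?_
  simp [ofVec]
  ring

lemma eval_jContrPow_ofVec {k : ℕ} (y : EuclideanSpace ℝ (Fin n)) (p : ℕ)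
    (t : Tensor n (k + 1 * p)) (v : Fin k → EuclideanSpace ℝ (Fin n)) :
    eval (jContrPow (ofVec y) p t) v = eval t (Fin.append v fun _ => y) := by
  induction p with
  | zero =>
    rw [jContrPow]
    congr 1
    ext1 a
    exact (Fin.append_left v (fun _ : Fin (1 * 0) => y) a).symm
  | succ p ih =>
    rw [jContrPow, ih, eval_jContr_ofVec, eval_cast]
    congr 1
    ext1 a
    refine Fin.addCases (fun a => ?_) (fun a => ?_) a
    · rw [Fin.append_left, Function.comp_apply]
      have : Fin.cast (by ring) (Fin.castAdd (1 * (p + 1)) a) =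
          Fin.castAdd 1 (Fin.castAdd (1 * p) a) := rfl
      rw [this, Fin.append_left, Fin.append_left]
    · rw [Fin.append_right, Function.comp_apply]
      simp [Fin.append, Fin.addCases]

lemma eval_fieldA (m k : ℕ) (y : EuclideanSpace ℝ (Fin n))
    (v : Fin (2 * m - k) → EuclideanSpace ℝ (Fin n)) :
    eval (fieldA n m k y) v = ((iteratedFDeriv ℝ (2 * m - k)
      (fun x : EuclideanSpace ℝ (Fin n) => ‖x‖ ^ (2 * (m : ℤ) - 2 * (k : ℤ) - 1)) y v : ℝ) : ℂ) := by
  have hv : v = fun a => ∑ j, v a j • EuclideanSpace.single j (1 : ℝ) := by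
    ext1 a
    ext j
    simp [Finset.sum_apply, Pi.single_apply]
  conv_rhs => rw [hv, ContinuousMultilinearMap.map_sum]
  simp only [ContinuousMultilinearMap.map_smul_univ]
  push_cast
  refine sum_congr rfl fun i _ => ?_
  rw [fieldA]
  simp [mul_comm]

/-- `eval` as a continuous multilinear map. -/
noncomputable def evalCMM {r : ℕ} (u : Tensor n r) :
    ContinuousMultilinearMap ℝ (fun _ : Fin r => EuclideanSpace ℝ (Fin n)) ℂ :=
  ∑ i, u i • (ContinuousMultilinearMap.mkPiAlgebra ℝ (Fin r) ℂ).compContinuousLinearMap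
    fun a => Complex.ofRealCLM ∘L EuclideanSpace.proj (i a)

lemma evalCMM_apply {r : ℕ} (u : Tensor n r) (v : Fin r → EuclideanSpace ℝ (Fin n)) :
    evalCMM u v = eval u v := by
  simp [evalCMM, eval, _root_.sum_apply]

lemma eval_single {r : ℕ} (u : Tensor n r) (l : Fin r → Fin n) :
    eval u (fun a => EuclideanSpace.single (l a) (1 : ℝ)) = u l := by
  rw [eval, sum_eq_single l]
  · simp
  · intro l' _ hl'
    obtain ⟨a, ha⟩ := Function.ne_iff.1 hl'
    rw [prod_eq_zero (mem_univ a) (by simp [ha])]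
    simp
  · simp

/-- Polarization: a symmetric tensor is determined by the associated homogeneous polynomial. -/
lemma ext_of_eval_const {r : ℕ} {u v : Tensor n r} (hu : u ∈ symm n r) (hv : v ∈ symm n r)
    (h : ∀ x, eval u (fun _ => x) = eval v (fun _ => x)) : u = v := by
  have h0 : (fun x => evalCMM u fun _ => x) = fun x => evalCMM v fun _ => x := by
    ext1 x
    rw [evalCMM_apply, evalCMM_apply, h]
  have key : ∀ {u : Tensor n r}, u ∈ symm n r → ∀ l : Fin r → Fin n,
      iteratedFDeriv ℝ r (fun x => evalCMM u fun _ => x) 0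
        (fun a => EuclideanSpace.single (l a) (1 : ℝ)) = r.factorial * u l := by
    intro u hu l
    -- The `r`-th derivative of the diagonal form is a sum over permutations of the arguments; by
    -- symmetry its `r!` terms coincide.
    rw [ContinuousMultilinearMap.iteratedFDeriv_comp_diagonal]
    have : ∀ σ : Equiv.Perm (Fin r),
        evalCMM u (fun a => EuclideanSpace.single (l (σ a)) (1 : ℝ)) = u l := by
      intro σ
      rw [evalCMM_apply]
      exact (eval_single u (l ∘ σ)).trans (hu σ l)
    simp [this, Fintype.card_perm]
  ext1 l
  have h1 := key hu l
  rw [h0, key hv l] at h1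
  exact (mul_left_cancel₀ (by exact_mod_cast r.factorial_ne_zero) h1).symm

lemma cast_mem_symm {a b : ℕ} (h : a = b) {u : Tensor n a} (hu : u ∈ symm n a) :
    cast h u ∈ symm n b := by
  subst h
  exact hu

lemma symmetrize_mem_symm {r : ℕ} (u : Tensor n r) : symmetrize u ∈ symm n r := by
  intro π i
  simp only [symmetrize]
  congr 1
  exact Equiv.sum_comp (Equiv.mulLeft π) fun τ : Equiv.Perm (Fin r) => u (i ∘ τ)

lemma iMulPow_mem_symm {k r : ℕ} (u : Tensor n r) (p : ℕ) {v : Tensor n k}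
    (h : p = 0 → v ∈ symm n k) : iMulPow u p v ∈ symm n (k + r * p) := by
  cases p with
  | zero => exact h rfl
  | succ p => exact cast_mem_symm _ (symmetrize_mem_symm _)

end Tensor

/-! ### Reduction of the system to the identity for powers of the norm. -/

lemma ContDiffAt.iteratedFDeriv_congr_equiv {E ι : Type*} [NormedAddCommGroup E] [NormedSpace ℝ E]
    {φ : E → ℝ} {z : E} (h : ContDiffAt ℝ ω φ z) {M N : ℕ} (e : ι ≃ Fin M) (e' : ι ≃ Fin N)
    {v : Fin M → E} {v' : Fin N → E} (hv : ∀ i, v (e i) = v' (e' i)) :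
    iteratedFDeriv ℝ M φ z v = iteratedFDeriv ℝ N φ z v' := by
  rw [← h.iteratedFDeriv_comp_equiv (e.symm.trans e') v']
  congr 1
  ext1 a
  simpa using hv (e.symm a)

namespace Tensor

variable {n : ℕ}

/-- The contraction of `A / g` with `p` copies of `y` and copies of `x`. -/
lemma eval_jContr_fieldA {m k p : ℕ} (g : Tensor n m)
    (x : EuclideanSpace ℝ (Fin n)) {y : EuclideanSpace ℝ (Fin n)} (hy : y ≠ 0)
    (h : 2 * m - k = (m - k) + m) (h' : m - k = (m - k - p) + 1 * p) :
    eval (jContr g (cast h (fieldA n m k y)))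
      ((Fin.append (fun _ : Fin (m - k - p) => x) (fun _ : Fin (1 * p) => y)) ∘ Fin.cast h') =
    ∑ l, g l * ((iteratedFDeriv ℝ (p + (m + (m - k - p)))
      (fun x : EuclideanSpace ℝ (Fin n) => ‖x‖ ^ (2 * (m : ℤ) - 2 * (k : ℤ) - 1)) y
      (Fin.append (fun _ => y) (Fin.append (fun a => EuclideanSpace.single (l a) (1 : ℝ))
        (fun _ => x))) : ℝ) : ℂ) := by
  rw [eval_jContr]
  refine sum_congr rfl fun l _ => ?_
  rw [eval_cast, eval_fieldA]
  congr 2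
  -- The slots are ordered `y`, basis vectors, `x` for `e`, and `x`, `y`, basis vectors for `e'`;
  -- both are labelled by one sum type.
  let e : Fin p ⊕ (Fin m ⊕ Fin (m - k - p)) ≃ Fin (p + (m + (m - k - p))) :=
    ((Equiv.refl _).sumCongr finSumFinEquiv).trans finSumFinEquiv
  let e' : Fin p ⊕ (Fin m ⊕ Fin (m - k - p)) ≃ Fin (2 * m - k) :=
    (Equiv.sumComm _ _).trans <| (Equiv.sumAssoc _ _ _).trans <| (Equiv.sumComm _ _).trans <|
      (((((Equiv.refl _).sumCongr (finCongr (one_mul p).symm)).trans finSumFinEquiv).trans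
        (finCongr h'.symm)).sumCongr (Equiv.refl _)).trans <|
      finSumFinEquiv.trans (finCongr h.symm)
  refine (isEuler_norm_zpow _ y hy).1.iteratedFDeriv_congr_equiv e' e ?_
  rintro (i | i | i)
  · change Fin.append _ _ (Fin.castAdd m (Fin.cast h'.symm (Fin.natAdd (m - k - p)
      (Fin.cast (one_mul p).symm i)))) = Fin.append _ _ (Fin.castAdd _ i)
    rw [Fin.append_left, Fin.append_left]
    exact Fin.append_right _ _ _
  · simp [e, e']
  · change Fin.append _ _ (Fin.castAdd m (Fin.cast h'.symm (Fin.castAdd (1 * p) i))) =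
      Fin.append _ _ (Fin.natAdd p (Fin.natAdd m i))
    rw [Fin.append_left, Fin.append_right, Fin.append_right]
    exact Fin.append_left _ _ _

end Tensor

/-- The system determines its solution. The identities between ranks are hypotheses, so that the
formula holds for whichever proofs of them it is written with. -/
lemma IsSystemSolution.eq_sum {n m : ℕ}
    {H : (k : Fin (m + 1)) → PuncturedSpace n → Tensor.symm n (m - k)}
    {g : PuncturedSpace n → Tensor.symm n m} (hg : IsSystemSolution H g) (y : PuncturedSpace n)
    (h₁ : ∀ (k : Fin (m + 1)) (p : Fin (min (k : ℕ) (m - k) + 1)),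
      (m - k - p) + 1 * (k - p) + 2 * p = m)
    (h₂ : ∀ (k : Fin (m + 1)) (p : Fin (min (k : ℕ) (m - k) + 1)),
      m - (k : ℕ) = (m - k - p) + 1 * p) :
    (g y : Tensor n m) =
      ((‖(y : EuclideanSpace ℝ (Fin n))‖ : ℂ) / (m.factorial : ℂ)) •
        ∑ k : Fin (m + 1),
          ((-1 : ℂ) ^ (k : ℕ) / (Nat.doubleFactorial (2 * (m - k) - 1) : ℂ) *
              (m.choose k : ℂ)) •
            ∑ p : Fin (min (k : ℕ) (m - k) + 1),
              ((-1 : ℂ) ^ (p : ℕ) / 2 ^ (p : ℕ) * ((m - k).choose p : ℂ)) •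
                Tensor.cast (h₁ k p)
                  (Tensor.iMulPow (Tensor.kronecker n) p
                    (Tensor.iMulPow (Tensor.ofVec y) (k - p)
                      (Tensor.jContrPow (Tensor.ofVec y) p
                        (Tensor.cast (h₂ k p)
                          (H k y : Tensor n (m - k)))))) := by
  refine Tensor.ext_of_eval_const (g y).2 ?_ fun x => ?_
  · refine Submodule.smul_mem _ _ (Submodule.sum_mem _ fun k _ => Submodule.smul_mem _ _
      (Submodule.sum_mem _ fun p _ => Submodule.smul_mem _ _ (Tensor.cast_mem_symm _
        (Tensor.iMulPow_mem_symm _ _ fun hp => Tensor.iMulPow_mem_symm _ _ fun _ => ?_))))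
    -- Symmetry of the innermost tensor is needed only when neither multiplication symmetrizes. Then
    -- `p = 0`, and the tensor is `H` itself.
    obtain ⟨p, hp'⟩ := p
    obtain rfl : p = 0 := hp
    exact Tensor.cast_mem_symm _ (H k y).2
  · have hterm : ∀ (k : Fin (m + 1)) (p : Fin (min (k : ℕ) (m - k) + 1)),
        Tensor.eval (Tensor.cast (h₁ k p)
          (Tensor.iMulPow (Tensor.kronecker n) p
            (Tensor.iMulPow (Tensor.ofVec y) (k - p)
              (Tensor.jContrPow (Tensor.ofVec y) p
                (Tensor.cast (h₂ k p)
                  (H k y : Tensor n (m - k))))))) (fun _ => x) =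
        ∑ l, (g y : Tensor n m) l * (((‖x‖ ^ 2) ^ (p : ℕ) * (inner ℝ x y.1) ^ ((k : ℕ) - p) *
          iteratedFDeriv ℝ (p + (m + (m - k - p)))
            (fun z : EuclideanSpace ℝ (Fin n) => ‖z‖ ^ (2 * (m : ℤ) - 2 * ((k : ℕ) : ℤ) - 1)) y
            (Fin.append (fun _ => y.1) (Fin.append (fun a => EuclideanSpace.single (l a) (1 : ℝ))
              (fun _ => x))) : ℝ) : ℂ) := by
      intro k p
      rw [Tensor.eval_cast]
      change Tensor.eval _ (fun _ => x) = _
      rw [Tensor.eval_iMulPow, Tensor.eval_iMulPow, Tensor.eval_kronecker, Tensor.eval_ofVec,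
        Tensor.eval_jContrPow_ofVec, Tensor.eval_cast, ← hg k y,
        Tensor.eval_jContr_fieldA _ _ y.2, mul_sum, mul_sum]
      refine sum_congr rfl fun l _ => ?_
      push_cast
      ring
    rw [Tensor.eval_smul, Tensor.eval_sum]
    simp only [Tensor.eval_smul, Tensor.eval_sum, hterm]
    have hgx : Tensor.eval (g y : Tensor n m) (fun _ => x) = ∑ l, (g y : Tensor n m) l *
        ((∏ a, inner ℝ x (EuclideanSpace.single (l a) (1 : ℝ)) : ℝ) : ℂ) := by
      simp [Tensor.eval, EuclideanSpace.inner_single_right]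
    rw [hgx]
    -- The norm identity is applied with `w` the basis vectors `e_{l₁}, …, e_{l_m}`, separately for
    -- each component `g_l`.
    simp only [← sum_iteratedFDeriv_append_norm_zpow m x y.2, Finset.sum_range, Complex.ofReal_mul,
      Complex.ofReal_sum, mul_sum]
    rw [sum_comm]
    refine sum_congr rfl fun k _ => ?_
    rw [sum_comm]
    refine sum_congr rfl fun p _ => sum_congr rfl fun l _ => ?_
    push_cast
    ring

theorem proposition6p1 (n m : ℕ)
    (H : (k : Fin (m + 1)) → PuncturedSpace n → Tensor.symm n (m - k))
    (hsol : ∃ g : PuncturedSpace n → Tensor.symm n m, IsSystemSolution H g) :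
    (∃! g : PuncturedSpace n → Tensor.symm n m, IsSystemSolution H g) ∧
    ∀ g : PuncturedSpace n → Tensor.symm n m, IsSystemSolution H g →
      ∀ y : PuncturedSpace n,
        (g y : Tensor n m) =
          ((‖(y : EuclideanSpace ℝ (Fin n))‖ : ℂ) / (m.factorial : ℂ)) •
            ∑ k : Fin (m + 1),
              ((-1 : ℂ) ^ (k : ℕ) / (Nat.doubleFactorial (2 * (m - k) - 1) : ℂ) *
                  (m.choose k : ℂ)) •
                ∑ p : Fin (min (k : ℕ) (m - k) + 1),
                  ((-1 : ℂ) ^ (p : ℕ) / 2 ^ (p : ℕ) * ((m - k).choose p : ℂ)) •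
                    Tensor.cast (by omega : (m - k - p) + 1 * (k - p) + 2 * p = m)
                      (Tensor.iMulPow (Tensor.kronecker n) p
                        (Tensor.iMulPow (Tensor.ofVec y) (k - p)
                          (Tensor.jContrPow (Tensor.ofVec y) p
                            (Tensor.cast (by omega : m - (k : ℕ) = (m - k - p) + 1 * p)
                              (H k y : Tensor n (m - k)))))) := by
  have h₁ : ∀ (k : Fin (m + 1)) (p : Fin (min (k : ℕ) (m - k) + 1)),
      (m - k - p) + 1 * (k - p) + 2 * p = m := by omega
  have h₂ : ∀ (k : Fin (m + 1)) (p : Fin (min (k : ℕ) (m - k) + 1)),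
      m - (k : ℕ) = (m - k - p) + 1 * p := by omega
  refine ⟨?_, fun g hg y => hg.eq_sum y h₁ h₂⟩
  obtain ⟨g, hg⟩ := hsol
  refine ⟨g, hg, fun g' hg' => ?_⟩
  ext1 y
  exact Subtype.ext ((hg'.eq_sum y h₁ h₂).trans (hg.eq_sum y h₁ h₂).symm)
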